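/- Let $\mathfrak A$ be a combinatorial problem: every instance $x$ (a finite object, given by an encoding) determines a ground set $\mathcal U=[n]$ with $n=n(x)\ge 2$ and, implicitly, a non-empty family $\mathcal F\subseteq 2^{\mathcal U}$ of feasible sets. For a value vector $v\in\mathbb Q_{\ge 0}^n$ and $S\subseteq\mathcal U$, let $v[S]$ be the vector obtained from $v$ by replacing the entries outside $S$ by $0$. The min-sum version of $\mathfrak A$ asks, given $(x,v)$, for $S\in\mathcal F$ minimizing $\sum_{e\in S}v_e$. The $\mathsf{MinNorm}$ version asks, given $(x,v)$ and a symmetric monotone norm $f:\mathbb R^n\to\mathbb R_{\ge0}$, for $S\in\mathcal F$ minimizing $f(v[S])$. Here a norm $f$ is monotone if $f(u)\le f(w)$ whenever $0\le u\le w$ coordinatewise, and symmetric if it is invariant under permutations of the coordinates. The norm is accessed through an oracle that tells, for rational vectors $u,w\in\mathbb Q^n$, whether $f(u)\le f(w)$. An algorithm has approximation factor $\rho$ if on every input it returns some $S\in\mathcal F$ whose objective value is at most $\rho$ times the optimum. Algorithms are deterministic, and polynomial time means that the number of bit operations is polynomial in the encoding length of $(x,v)$, with numbers written in binary and each oracle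 call charged the length of its query and its answer. Let $\alpha\ge 1$ (possibly depending on $n$). If the min-sum version of $\mathfrak A$ has a polynomial-time approximation algorithm with factor $\alpha$, then for every constant $\epsilon>0$ the $\mathsf{MinNorm}$ version of $\mathfrak A$ has a polynomial-time approximation algorithm with factor $4\alpha\lceil\log_2 n\rceil+\epsilon$. The algorithm and its time bound are the same for all instances, value vectors and norms. -/

import Mathlib

namespace MinNorm

/-! ## The model of computation

Programs of a while-language act on finite binary trees with rational leaves. The running time is
the logarithmic cost: every elementary operation is charged the bit length of all data that it
reads and writes, so polynomial time is the usual (Turing machine) polynomial time. -/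

/-- Finite binary trees whose leaves carry rational numbers. -/
inductive Data where
  | num (q : ℚ) : Data
  | pair (a b : Data) : Data

namespace Data

/-- Bit length: rationals are written in lowest terms, numerator and denominator in binary. -/
def size : Data → ℕ
  | num q => 1 + Nat.size q.num.natAbs + Nat.size q.den
  | pair a b => 1 + a.size + b.size

/-- A list as a right comb that ends in the leaf `0`. -/
def ofList : List Data → Data
  | [] => num 0
  | a :: l => pair a (ofList l)

/-- The code of a rational vector: the list of its entries. -/
def ofVec {n : ℕ} (v : Fin n → ℚ) : Data :=
  ofList (List.ofFn fun i => num (v i))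

/-- The code of a subset of `Fin n`: its `0`/`1` incidence vector. -/
def ofSet {n : ℕ} (S : Finset (Fin n)) : Data :=
  ofVec fun i => if i ∈ S then 1 else 0

/-- Apply a binary operation to a pair of numbers; the result is `0` on data of any other shape. -/
def arith (g : ℚ → ℚ → ℚ) : Data → Data
  | pair (num a) (num b) => num (g a b)
  | _ => num 0

end Data

/-- The elementary operations. -/
inductive Op where
  | id
  | const (q : ℚ)
  | fst
  | snd
  | isNum
  | add
  | sub
  | mul
  | div
  | le

/-- The effect of an elementary operation. Truth values are the numbers `1` and `0`, and
division by zero gives `0`. -/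
def Op.eval : Op → Data → Data
  | .id, x => x
  | .const q, _ => .num q
  | .fst, .pair a _ => a
  | .fst, .num _ => .num 0
  | .snd, .pair _ b => b
  | .snd, .num _ => .num 0
  | .isNum, .num _ => .num 1
  | .isNum, .pair _ _ => .num 0
  | .add, x => x.arith fun a b => a + b
  | .sub, x => x.arith fun a b => a - b
  | .mul, x => x.arith fun a b => a * b
  | .div, x => x.arith fun a b => a / b
  | .le, x => x.arith fun a b => if a ≤ b then 1 else 0

/-- Programs with access to oracles named by `κ` (with `κ = Empty`: programs without oracles). -/
inductive Prog (κ : Type) where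
  | prim (o : Op) : Prog κ
  | query (k : κ) : Prog κ
  /-- run both programs on the input and pair the results -/
  | pair (p q : Prog κ) : Prog κ
  /-- run `p`, then run `q` on its result -/
  | seq (p q : Prog κ) : Prog κ
  /-- run `p` if the test `c` succeeds (gives anything but `0`), otherwise run `q` -/
  | ite (c p q : Prog κ) : Prog κ
  /-- as long as the test `c` succeeds on the current data, replace the data by `p` of it -/
  | loop (c p : Prog κ) : Prog κ

/-- `Runs O p x y t`: with the oracles `O`, the program `p` halts on the input `x` with the
output `y`, in time `t`. -/
inductive Runs {κ : Type} (O : κ → Data → Data) : Prog κ → Data → Data → ℕ → Prop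
  | prim (o : Op) (x : Data) :
      Runs O (.prim o) x (o.eval x) (1 + x.size + (o.eval x).size)
  | query (k : κ) (x : Data) :
      Runs O (.query k) x (O k x) (1 + x.size + (O k x).size)
  | pair {p q : Prog κ} {x y z : Data} {s t : ℕ} :
      Runs O p x y s → Runs O q x z t →
      Runs O (.pair p q) x (.pair y z) (1 + x.size + s + t)
  | seq {p q : Prog κ} {x y z : Data} {s t : ℕ} :
      Runs O p x y s → Runs O q y z t →
      Runs O (.seq p q) x z (1 + s + t)
  | ite_true {c p q : Prog κ} {x b y : Data} {s t : ℕ} :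
      Runs O c x b s → b ≠ .num 0 → Runs O p x y t →
      Runs O (.ite c p q) x y (1 + x.size + s + t)
  | ite_false {c p q : Prog κ} {x b y : Data} {s t : ℕ} :
      Runs O c x b s → b = .num 0 → Runs O q x y t →
      Runs O (.ite c p q) x y (1 + x.size + s + t)
  | loop_stop {c p : Prog κ} {x b : Data} {s : ℕ} :
      Runs O c x b s → b = .num 0 →
      Runs O (.loop c p) x x (1 + x.size + s)
  | loop_step {c p : Prog κ} {x b y z : Data} {s t u : ℕ} :
      Runs O c x b s → b ≠ .num 0 → Runs O p x y t → Runs O (.loop c p) y z u →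
      Runs O (.loop c p) x z (1 + x.size + s + t + u)

/-! ## Combinatorial problems and norms -/

/-- A combinatorial problem: a set of instances (finite objects, given as data), and for each
instance `x` a ground set `Fin (n x)` and a non-empty family of feasible subsets of it. The family
is given only implicitly, through `x`. -/
structure CombProblem where
  inst : Set Data
  n : Data → ℕ
  feasible : (x : Data) → Set (Finset (Fin (n x)))
  feasible_nonempty : ∀ x ∈ inst, (feasible x).Nonempty

/-- Symmetric monotone norms on `ℝⁿ`. -/
structure IsSymmMonoNorm {n : ℕ} (f : (Fin n → ℝ) → ℝ) : Prop where
  nonneg : ∀ v, 0 ≤ f v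
  eq_zero_iff : ∀ v, f v = 0 ↔ v = 0
  add_le : ∀ u v, f (u + v) ≤ f u + f v
  smul : ∀ (θ : ℝ) (v), f (θ • v) = |θ| * f v
  mono : ∀ u v, 0 ≤ v → v ≤ u → f v ≤ f u
  symm : ∀ (σ : Equiv.Perm (Fin n)) (v), f (v ∘ σ) = f v

/-- A rational vector as a real vector. -/
def realVec {n : ℕ} (v : Fin n → ℚ) : Fin n → ℝ := fun i => (v i : ℝ)

/-- The value vector `v[S]` induced by `S`: the entries outside `S` are set to zero. -/
def induced {n : ℕ} (v : Fin n → ℚ) (S : Finset (Fin n)) : Fin n → ℝ :=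
  fun i => if i ∈ S then (v i : ℝ) else 0

open Classical in
/-- `O` is an oracle for the norm `f`: on every pair of rational vectors `(u, w)` it tells
whether `f u ≤ f w`. Nothing is promised about its answers on other data. -/
def IsNormOracle {n : ℕ} (f : (Fin n → ℝ) → ℝ) (O : Data → Data) : Prop :=
  ∀ u w : Fin n → ℚ, O (.pair (.ofVec u) (.ofVec w)) =
    if f (realVec u) ≤ f (realVec w) then .num 1 else .num 0

/-! ## Polynomial-time approximation algorithms -/

/-- The min-sum version of `P` has a polynomial-time approximation algorithm with factor `ρ n`
on instances with `n` elements: the input is an instance with a non-negative rational value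
vector, the output is a feasible set whose total value is at most `ρ n` times that of every
feasible set. -/
def HasPolyMinSumApprox (P : CombProblem) (ρ : ℕ → ℝ) : Prop :=
  ∃ (p : Prog Empty) (T : Polynomial ℕ), ∀ x ∈ P.inst, ∀ v : Fin (P.n x) → ℚ, (∀ i, 0 ≤ v i) →
    ∃ (S : Finset (Fin (P.n x))) (t : ℕ),
      Runs (fun k => k.elim) p (.pair x (.ofVec v)) (.ofSet S) t ∧
      t ≤ T.eval (Data.pair x (.ofVec v)).size ∧
      S ∈ P.feasible x ∧
      ∀ S' ∈ P.feasible x, ∑ i ∈ S, (v i : ℝ) ≤ ρ (P.n x) * ∑ i ∈ S', (v i : ℝ)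

/-- The norm minimization version of `P` has a polynomial-time approximation algorithm with
factor `ρ n` on instances with `n` elements: the input is an instance with a non-negative rational
value vector and, through an oracle, a symmetric monotone norm `f`; the output is a feasible set
`S` such that `f (v[S])` is at most `ρ n` times `f (v[S'])` for every feasible set `S'`. One
program and one time bound serve all instances, value vectors and norms. -/
def HasPolyMinNormApprox (P : CombProblem) (ρ : ℕ → ℝ) : Prop :=
  ∃ (p : Prog Unit) (T : Polynomial ℕ), ∀ x ∈ P.inst, ∀ v : Fin (P.n x) → ℚ, (∀ i, 0 ≤ v i) →
    ∀ f : (Fin (P.n x) → ℝ) → ℝ, IsSymmMonoNorm f → ∀ O : Data → Data, IsNormOracle f O →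
    ∃ (S : Finset (Fin (P.n x))) (t : ℕ),
      Runs (fun _ => O) p (.pair x (.ofVec v)) (.ofSet S) t ∧
      t ≤ T.eval (Data.pair x (.ofVec v)).size ∧
      S ∈ P.feasible x ∧
      ∀ S' ∈ P.feasible x, f (induced v S) ≤ ρ (P.n x) * f (induced v S')

end MinNorm

/-!
The norm is reduced to a linear objective. Write `‖y × d‖` for the norm of `d` copies of `y`, padded
with zeros. Suppose that `g` is a guess of the optimum: the norm `‖g × 1‖` of a single entry `g` is
at least the norm of an optimal set `S'`, and at most `4/3` times as large. An element of value `y`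
gets the cost `g / 2 ^ i` for the largest `i` with `‖y × 2 ^ i‖ ≤ ‖g × 1‖`, the cost `0` if even
`‖y × n‖ ≤ ‖g × 1‖`, and the cost `y` if already `‖y × 1‖ > ‖g × 1‖`. Let `K = ⌈log₂ n⌉`; there are
`K` classes of elements of cost `g / 2 ^ i`.

* The optimal set is cheap (`IsSymmMonoNorm.sum_cost_le`): it has no element of the last kind, and
  fewer than `2 ^ (i + 1)` elements of cost `g / 2 ^ i`, since so many would have norm above the
  guess. Its cost is at most `(2 * K - 1) * g`.
* Cheap sets have small norm (`IsSymmMonoNorm.induced_le_sum_cost`): a class of cost `g / 2 ^ i` is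
  cut into packets of `2 ^ i` elements, each of norm at most `‖g × 1‖`, and the rounding costs one
  packet for each class. A set of cost `c` has norm at most `‖c × 1‖ + (K + 1) * ‖g × 1‖`.

So the set that the min-sum algorithm returns for these costs has norm at most
`(α * (2 * K - 1) + K + 1) * ‖g × 1‖ ≤ 3 * α * K * ‖g × 1‖`, which is at most `4 * α * K` times the
optimum. A suitable guess is the product of the largest value in the optimal set with `0` or with
`(4/3) ^ k` for some `k ≤ n + 1` (`IsSymmMonoNorm.exists_guess`), so all guesses of this form are
tried, and the oracle selects the best of the sets found.

Polynomial time is handled by the predicate `PolyTime`, which is closed under composition, pairing,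
branching, arithmetic, and loops with bounded data (`PolyTime.loop`), hence under folds and maps
over lists. The program is never written down; it results from these closure properties.
-/

namespace MinNorm

/-! ### Quantities bounded by a polynomial -/

/-- The family `m` of natural numbers is bounded by one polynomial in the family `s`. -/
def PolyBdd {ι : Type*} (s m : ι → ℕ) : Prop :=
  ∃ B : Polynomial ℕ, ∀ i, m i ≤ B.eval (s i)

theorem eval_natPolynomial_mono (B : Polynomial ℕ) : Monotone fun n : ℕ => B.eval n := by
  intro a b h
  induction B using Polynomial.induction_on' with
  | add p q hp hq => simpa only [Polynomial.eval_add] using add_le_add hp hq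
  | monomial k c => simpa only [Polynomial.eval_monomial] using by gcongr

namespace PolyBdd

variable {ι : Type*} {s m m' : ι → ℕ}

theorem mono (h : PolyBdd s m) (hm : ∀ i, m' i ≤ m i) : PolyBdd s m' := by
  obtain ⟨B, hB⟩ := h
  exact ⟨B, fun i => (hm i).trans (hB i)⟩

theorem const (c : ℕ) : PolyBdd s fun _ => c := ⟨Polynomial.C c, fun i => by simp⟩

theorem refl : PolyBdd s s := ⟨Polynomial.X, fun i => by simp⟩

theorem add (h : PolyBdd s m) (h' : PolyBdd s m') : PolyBdd s fun i => m i + m' i := by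
  obtain ⟨B, hB⟩ := h
  obtain ⟨B', hB'⟩ := h'
  exact ⟨B + B', fun i => by simpa using add_le_add (hB i) (hB' i)⟩

theorem mul (h : PolyBdd s m) (h' : PolyBdd s m') : PolyBdd s fun i => m i * m' i := by
  obtain ⟨B, hB⟩ := h
  obtain ⟨B', hB'⟩ := h'
  exact ⟨B * B', fun i => by simpa using Nat.mul_le_mul (hB i) (hB' i)⟩

theorem trans (h : PolyBdd s m) (h' : PolyBdd m m') : PolyBdd s m' := by
  obtain ⟨B, hB⟩ := h
  obtain ⟨B', hB'⟩ := h'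
  refine ⟨B'.comp B, fun i => ?_⟩
  rw [Polynomial.eval_comp]
  exact (hB' i).trans (eval_natPolynomial_mono B' (hB i))

theorem reindex {κ : Type*} (h : PolyBdd s m) (φ : κ → ι) :
    PolyBdd (fun j => s (φ j)) fun j => m (φ j) := by
  obtain ⟨B, hB⟩ := h
  exact ⟨B, fun j => hB (φ j)⟩

end PolyBdd

/-! ### Bit lengths -/

namespace Data

theorem one_le_size (x : Data) : 1 ≤ x.size := by
  cases x <;> simp [size] <;> omega

theorem natSize_mul_le (a b : ℕ) : Nat.size (a * b) ≤ Nat.size a + Nat.size b := by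
  rw [Nat.size_le, pow_add]
  exact Nat.mul_lt_mul'' (Nat.lt_size_self a) (Nat.lt_size_self b)

theorem natSize_add_le (a b : ℕ) : Nat.size (a + b) ≤ Nat.size a + Nat.size b + 1 := by
  rw [Nat.size_le]
  have ha := Nat.lt_size_self a
  have hb := Nat.lt_size_self b
  have h1 : 2 ^ a.size ≤ 2 ^ (a.size + b.size) := Nat.pow_le_pow_right (by norm_num) (by omega)
  have h2 : 2 ^ b.size ≤ 2 ^ (a.size + b.size) := Nat.pow_le_pow_right (by norm_num) (by omega)
  rw [pow_succ]
  omega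

/-- Cancelling a fraction does not lengthen it. -/
theorem size_num_div_le (a b : ℤ) (hb : b ≠ 0) :
    (num ((a : ℚ) / b)).size ≤ 1 + Nat.size a.natAbs + Nat.size b.natAbs := by
  rw [← Rat.divInt_eq_div]
  have h2 : (Rat.divInt a b).den ∣ b.natAbs := by
    have := Rat.den_dvd a b
    exact Int.natCast_dvd.mp this
  have h3 : Nat.size (Rat.divInt a b).den ≤ Nat.size b.natAbs :=
    Nat.size_le_size (Nat.le_of_dvd (Int.natAbs_pos.mpr hb) h2)
  have h4 : Nat.size (Rat.divInt a b).num.natAbs ≤ Nat.size a.natAbs := by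
    rcases eq_or_ne a 0 with rfl | ha
    · simp
    · exact Nat.size_le_size (Nat.le_of_dvd (Int.natAbs_pos.mpr ha)
        (Int.natAbs_dvd_natAbs.mpr (Rat.num_dvd a hb)))
  simp only [size]
  omega

theorem size_num_mul_le (a b : ℚ) : (num (a * b)).size ≤ (num a).size + (num b).size := by
  have h := size_num_div_le (a.num * b.num) (a.den * b.den) (by simp)
  have e : ((a.num * b.num : ℤ) : ℚ) / ((a.den * b.den : ℤ) : ℚ) = a * b := by
    push_cast
    rw [mul_div_mul_comm, Rat.num_div_den, Rat.num_div_den]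
  rw [e] at h
  have h1 := natSize_mul_le a.num.natAbs b.num.natAbs
  have h2 := natSize_mul_le a.den b.den
  simp only [Int.natAbs_mul, Int.natAbs_natCast] at h
  simp only [size] at h ⊢
  omega

theorem size_num_neg (a : ℚ) : (num (-a)).size = (num a).size := by
  simp [size]

theorem size_num_add_le (a b : ℚ) :
    (num (a + b)).size ≤ 2 * (num a).size + 2 * (num b).size := by
  have h := size_num_div_le (a.num * b.den + b.num * a.den) (a.den * b.den) (by simp)
  have e : ((a.num * b.den + b.num * a.den : ℤ) : ℚ) / ((a.den * b.den : ℤ) : ℚ) = a + b := by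
    push_cast
    conv_rhs => rw [← Rat.num_div_den a, ← Rat.num_div_den b]
    have ha : (a.den : ℚ) ≠ 0 := by simp
    have hb : (b.den : ℚ) ≠ 0 := by simp
    field_simp
  rw [e] at h
  have h0 := Nat.size_le_size (Int.natAbs_add_le (a.num * b.den) (b.num * a.den))
  have h1 := natSize_add_le (a.num * b.den).natAbs (b.num * a.den).natAbs
  have h2 := natSize_mul_le a.num.natAbs b.den
  have h3 := natSize_mul_le b.num.natAbs a.den
  have h4 := natSize_mul_le a.den b.den
  simp only [Int.natAbs_mul, Int.natAbs_natCast] at h h0 h1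
  simp only [size] at h ⊢
  omega

theorem size_num_inv_le (a : ℚ) : (num a⁻¹).size ≤ (num a).size + 1 := by
  rcases eq_or_ne a 0 with rfl | ha
  · simp
  · have h := size_num_div_le a.den a.num (Rat.num_ne_zero.mpr ha)
    have e : ((a.den : ℤ) : ℚ) / (a.num : ℚ) = a⁻¹ := by
      conv_rhs => rw [← Rat.num_div_den a]
      rw [inv_div]
      simp
    rw [e] at h
    simp only [size, Int.natAbs_natCast] at h ⊢
    omega

theorem size_num_zero : (num 0).size = 2 := by decide +kernel

theorem size_num_one : (num 1).size = 3 := by decide +kernel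

theorem size_fst_le (x : Data) : (Op.fst.eval x).size ≤ x.size + 1 := by
  cases x with
  | num q => rw [Op.eval, size_num_zero]; have := one_le_size (num q); omega
  | pair a b => simp only [Op.eval, size]; omega

theorem size_snd_le (x : Data) : (Op.snd.eval x).size ≤ x.size + 1 := by
  cases x with
  | num q => rw [Op.eval, size_num_zero]; have := one_le_size (num q); omega
  | pair a b => simp only [Op.eval, size]; omega

theorem size_arith_le {g : ℚ → ℚ → ℚ}
    (hg : ∀ a b, (num (g a b)).size ≤ 2 * (num a).size + 2 * (num b).size + 3) (x : Data) :
    (x.arith g).size ≤ 2 * x.size + 3 := by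
  unfold arith
  split
  · rename_i a b
    have := hg a b
    have e : (pair (num a) (num b)).size = 1 + (num a).size + (num b).size := rfl
    omega
  · rw [size_num_zero]; omega

end Data

theorem Op.size_eval_le (o : Op) : ∃ c, ∀ x, (o.eval x).size ≤ 2 * x.size + c := by
  cases o with
  | id => exact ⟨0, fun x => by simp only [Op.eval]; omega⟩
  | const q => exact ⟨(Data.num q).size, fun x => by simp only [Op.eval]; omega⟩
  | fst => exact ⟨1, fun x => by have := Data.size_fst_le x; omega⟩
  | snd => exact ⟨1, fun x => by have := Data.size_snd_le x; omega⟩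
  | isNum =>
    refine ⟨3, fun x => ?_⟩
    cases x
    · simp only [Op.eval, Data.size_num_one]; omega
    · simp only [Op.eval, Data.size_num_zero]; omega
  | add =>
    refine ⟨3, fun x => Data.size_arith_le (fun a b => ?_) x⟩
    have := Data.size_num_add_le a b
    omega
  | sub =>
    refine ⟨3, fun x => Data.size_arith_le (fun a b => ?_) x⟩
    have := Data.size_num_add_le a (-b)
    rw [Data.size_num_neg, ← sub_eq_add_neg] at this
    omega
  | mul =>
    refine ⟨3, fun x => Data.size_arith_le (fun a b => ?_) x⟩
    have := Data.size_num_mul_le a b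
    omega
  | div =>
    refine ⟨3, fun x => Data.size_arith_le (fun a b => ?_) x⟩
    have := Data.size_num_mul_le a b⁻¹
    have h2 := Data.size_num_inv_le b
    rw [← div_eq_mul_inv] at this
    omega
  | le =>
    refine ⟨3, fun x => Data.size_arith_le (fun a b => ?_) x⟩
    split_ifs
    · rw [Data.size_num_one]; omega
    · rw [Data.size_num_zero]; omega

theorem Runs.size_le {κ : Type} {O : κ → Data → Data} {p : Prog κ} {x y : Data} {t : ℕ}
    (h : Runs O p x y t) : y.size ≤ t := by
  induction h <;> (try simp only [Data.size]) <;> omega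

/-! ### Families computed in polynomial time -/

/-- One program turns the data `a i` into the data `b i`, for every index `i`, in time polynomial
in the length of `a i`; the oracles may depend on `i`. The index type holds everything that the
data depend on, including what no program can see, such as a norm behind an oracle; restricting it
expresses preconditions. -/
def PolyTime {ι : Type*} {κ : Type} (O : ι → κ → Data → Data) (a b : ι → Data) : Prop :=
  ∃ (p : Prog κ) (t : ι → ℕ), (∀ i, Runs (O i) p (a i) (b i) (t i)) ∧
    PolyBdd (fun i => (a i).size) t

namespace PolyTime

variable {ι : Type*} {κ : Type} {O : ι → κ → Data → Data} {a b c d : ι → Data}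

theorem size (h : PolyTime O a b) : PolyBdd (fun i => (a i).size) fun i => (b i).size := by
  obtain ⟨p, t, h, ht⟩ := h
  exact ht.mono fun i => (h i).size_le

theorem reindex {ι' : Type*} (h : PolyTime O a b) (φ : ι' → ι) :
    PolyTime (fun j => O (φ j)) (fun j => a (φ j)) fun j => b (φ j) := by
  obtain ⟨p, t, h, ht⟩ := h
  exact ⟨p, fun j => t (φ j), fun j => h (φ j), ht.reindex φ⟩

theorem trans (h : PolyTime O a b) (h' : PolyTime O b c) : PolyTime O a c := by
  have hs := h.size
  obtain ⟨p, t, h, ht⟩ := h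
  obtain ⟨p', t', h', ht'⟩ := h'
  exact ⟨.seq p p', _, fun i => .seq (h i) (h' i),
    ((PolyBdd.const 1).add ht).add (hs.trans ht')⟩

theorem pair (h : PolyTime O a b) (h' : PolyTime O a c) :
    PolyTime O a fun i => .pair (b i) (c i) := by
  obtain ⟨p, t, h, ht⟩ := h
  obtain ⟨p', t', h', ht'⟩ := h'
  exact ⟨.pair p p', _, fun i => .pair (h i) (h' i),
    (((PolyBdd.const 1).add .refl).add ht).add ht'⟩

theorem op (o : Op) : PolyTime O a fun i => o.eval (a i) := by
  obtain ⟨k, hk⟩ := o.size_eval_le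
  refine ⟨.prim o, _, fun i => .prim o (a i), ((PolyBdd.const 1).add .refl).add ?_⟩
  exact (((PolyBdd.const 2).mul .refl).add (.const k)).mono fun i => hk (a i)

theorem refl : PolyTime O a a := op .id

theorem const (q : ℚ) : PolyTime O a fun _ => .num q := op (.const q)

theorem fst (h : PolyTime O a fun i => .pair (b i) (c i)) : PolyTime O a b := h.trans (op .fst)

theorem snd (h : PolyTime O a fun i => .pair (b i) (c i)) : PolyTime O a c := h.trans (op .snd)

theorem congr (h : PolyTime O a b) (hb : ∀ i, b i = c i) : PolyTime O a c := by
  rwa [funext hb] at h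

/-- A query is paid for if its answer is bounded. -/
theorem query (k : κ) (h : PolyTime O a b)
    (hs : PolyBdd (fun i => (b i).size) fun i => (O i k (b i)).size) :
    PolyTime O a fun i => O i k (b i) :=
  h.trans ⟨.query k, _, fun i => .query k (b i), ((PolyBdd.const 1).add .refl).add hs⟩

theorem ite {P : ι → Prop} [∀ i, Decidable (P i)]
    (hP : PolyTime O a fun i => if P i then .num 1 else .num 0)
    (hb : PolyTime O a b) (hc : PolyTime O a c) :
    PolyTime O a fun i => if P i then b i else c i := by
  obtain ⟨p, s, h, hs⟩ := hP
  obtain ⟨p', t, h', ht⟩ := hb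
  obtain ⟨p'', u, h'', hu⟩ := hc
  refine ⟨.ite p p' p'', fun i => 1 + (a i).size + s i + (if P i then t i else u i), fun i => ?_,
    (((PolyBdd.const 1).add .refl).add hs).add ((ht.add hu).mono fun i => ?_)⟩
  · have h1 := h i
    by_cases hi : P i
    · simp only [hi, if_true] at h1 ⊢
      exact .ite_true h1 (by simp) (h' i)
    · simp only [hi, if_false] at h1 ⊢
      exact .ite_false h1 rfl (h'' i)
  · split_ifs <;> omega

section Arithmetic

variable {q r : ι → ℚ}

theorem add (hq : PolyTime O a fun i => .num (q i)) (hr : PolyTime O a fun i => .num (r i)) :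
    PolyTime O a fun i => .num (q i + r i) := (hq.pair hr).trans (op .add)

theorem mul (hq : PolyTime O a fun i => .num (q i)) (hr : PolyTime O a fun i => .num (r i)) :
    PolyTime O a fun i => .num (q i * r i) := (hq.pair hr).trans (op .mul)

theorem div (hq : PolyTime O a fun i => .num (q i)) (hr : PolyTime O a fun i => .num (r i)) :
    PolyTime O a fun i => .num (q i / r i) := (hq.pair hr).trans (op .div)

theorem ite_le (hq : PolyTime O a fun i => .num (q i)) (hr : PolyTime O a fun i => .num (r i))
    (hb : PolyTime O a b) (hc : PolyTime O a c) :
    PolyTime O a fun i => if q i ≤ r i then b i else c i := by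
  refine ite (((hq.pair hr).trans (op .le)).congr fun i => ?_) hb hc
  simp only [Op.eval, Data.arith]
  split_ifs <;> rfl

end Arithmetic

/-! ### Loops -/

/-- A loop runs in polynomial time if the test and the body do, the number of rounds is bounded,
and so is the data in every round. Round `k` finds the data `st i k`. -/
theorem loop {st : ι → ℕ → Data} {N M : ι → ℕ} {test : (Σ i, Fin (N i + 1)) → Data}
    (htest : PolyTime (fun j : Σ i, Fin (N i + 1) => O j.1) (fun j => st j.1 j.2) test)
    (hend : ∀ j, test j = .num 0 ↔ (j.2 : ℕ) = N j.1)
    (hbody : PolyTime (fun j : Σ i, Fin (N i) => O j.1) (fun j => st j.1 j.2)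
      fun j => st j.1 (j.2 + 1))
    (hN : PolyBdd (fun i => (st i 0).size) N) (hM : PolyBdd (fun i => (st i 0).size) M)
    (hst : ∀ i, ∀ k ≤ N i, (st i k).size ≤ M i) :
    PolyTime O (fun i => st i 0) fun i => st i (N i) := by
  obtain ⟨c, s, hc, S, hS⟩ := htest
  obtain ⟨p, t, hp, T, hT⟩ := hbody
  set Q : ι → ℕ := fun i => 1 + M i + S.eval (M i) + T.eval (M i)
  have key : ∀ i, ∀ m k, k + m = N i →
      ∃ u, Runs (O i) (.loop c p) (st i k) (st i (N i)) u ∧ u ≤ (m + 1) * Q i := by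
    intro i m
    induction m with
    | zero =>
      intro k hk
      have hk' : k = N i := by omega
      subst hk'
      refine ⟨_, Runs.loop_stop (hc ⟨i, ⟨N i, by omega⟩⟩) ((hend _).2 rfl), ?_⟩
      have h1 := (hS ⟨i, ⟨N i, by omega⟩⟩).trans
        (eval_natPolynomial_mono S (hst i (N i) le_rfl))
      have h2 := hst i (N i) le_rfl
      simp only [Q] at *
      omega
    | succ m ih =>
      intro k hk
      obtain ⟨u, hu, hu'⟩ := ih (k + 1) (by omega)
      refine ⟨_, .loop_step (hc ⟨i, ⟨k, by omega⟩⟩) (fun h => ?_)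
        (hp ⟨i, ⟨k, by omega⟩⟩) hu, ?_⟩
      · have h' := (hend _).1 h
        simp only at h'
        omega
      · have hk' := hst i k (by omega)
        have h1 := (hS ⟨i, ⟨k, by omega⟩⟩).trans (eval_natPolynomial_mono S hk')
        have h2 := (hT ⟨i, ⟨k, by omega⟩⟩).trans (eval_natPolynomial_mono T hk')
        rw [add_mul, one_mul]
        simp only [Q] at *
        omega
  choose u hu hu' using fun i => key i (N i) 0 (by omega)
  refine ⟨.loop c p, u, hu, PolyBdd.mono ?_ hu'⟩
  exact (hN.add (.const 1)).mul
    ((((PolyBdd.const 1).add hM).add (hM.trans ⟨S, fun _ => le_rfl⟩)).add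
      (hM.trans ⟨T, fun _ => le_rfl⟩))

end PolyTime

/-! ### Programs on lists -/

namespace Data

theorem length_le_size_ofList (l : List Data) : l.length ≤ (ofList l).size := by
  induction l with
  | nil => simp
  | cons x l ih => simp only [List.length_cons, ofList, size]; omega

theorem size_ofList_le {l : List Data} {m : ℕ} (h : ∀ x ∈ l, x.size ≤ m) :
    (ofList l).size ≤ 2 + l.length * (m + 1) := by
  induction l with
  | nil => simp [ofList, size_num_zero]
  | cons x l ih =>
    have h1 := h x (by simp)
    have h2 := ih fun y hy => h y (by simp [hy])
    simp only [List.length_cons, ofList, size]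
    rw [add_mul, one_mul]
    omega

theorem size_le_size_ofList {l : List Data} {x : Data} (h : x ∈ l) :
    x.size ≤ (ofList l).size := by
  induction l with
  | nil => simp at h
  | cons y l ih =>
    simp only [ofList, size]
    rcases List.mem_cons.1 h with rfl | h
    · omega
    · have := ih h
      omega

theorem size_ofList_drop_le (l : List Data) (k : ℕ) :
    (ofList (l.drop k)).size ≤ (ofList l).size := by
  induction l generalizing k with
  | nil => simp
  | cons x l ih =>
    cases k with
    | zero => simp
    | succ k =>
      have := ih k
      simp only [List.drop_succ_cons, ofList, size]
      omega

theorem ofList_drop_ofFn {n : ℕ} (L : Fin n → Data) (k : Fin n) :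
    ofList ((List.ofFn L).drop k) = pair (L k) (ofList ((List.ofFn L).drop (k + 1))) := by
  rw [List.drop_eq_getElem_cons (by simp)]
  simp [ofList]

theorem ofList_reverse_take_ofFn {n : ℕ} (L : Fin n → Data) (k : Fin n) :
    ofList ((List.ofFn L).take (k + 1)).reverse =
      pair (L k) (ofList ((List.ofFn L).take k).reverse) := by
  rw [List.take_add_one]
  simp [ofList]

theorem ofList_eq_num_zero_iff (l : List Data) : ofList l = num 0 ↔ l = [] := by
  cases l <;> simp [ofList]

theorem size_ofList_reverse_take_le {n m : ℕ} {F : Fin n → Data} (h : ∀ k, (F k).size ≤ m)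
    (k : ℕ) : (ofList ((List.ofFn F).take k).reverse).size ≤ 2 + n * (m + 1) := by
  refine (size_ofList_le (m := m) fun x hx => ?_).trans ?_
  · obtain ⟨j, rfl⟩ := List.mem_ofFn.1 (List.mem_of_mem_take (List.mem_reverse.1 hx))
    exact h j
  · gcongr
    simp

end Data

namespace PolyTime

open Data

variable {ι : Type*} {κ : Type} {O : ι → κ → Data → Data} {a : ι → Data} {N : ι → ℕ}
  {L : ∀ i, Fin (N i) → Data}

theorem length (hL : PolyTime O a fun i => ofList (List.ofFn (L i))) :
    PolyBdd (fun i => (a i).size) N :=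
  hL.size.mono fun i => by simpa using length_le_size_ofList (List.ofFn (L i))

/-- The accumulator `s i k` is what a left fold over the list `L i` holds after `k` entries. The
step may use the original input `a i`. -/
theorem fold {s : ι → ℕ → Data} {M : ι → ℕ}
    (hL : PolyTime O a fun i => ofList (List.ofFn (L i)))
    (h0 : PolyTime O a fun i => s i 0)
    (hstep : PolyTime (fun j : Σ i, Fin (N i) => O j.1)
      (fun j => .pair (a j.1) (.pair (L j.1 j.2) (s j.1 j.2))) fun j => s j.1 (j.2 + 1))
    (hM : PolyBdd (fun i => (a i).size) M) (hs : ∀ i, ∀ k ≤ N i, (s i k).size ≤ M i) :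
    PolyTime O a fun i => s i (N i) := by
  let st : ι → ℕ → Data := fun i k =>
    .pair (a i) (.pair (ofList ((List.ofFn (L i)).drop k)) (s i k))
  have hinit : PolyTime O a fun i => st i 0 := refl.pair ((hL.congr fun i => by simp).pair h0)
  have hmono : PolyBdd (fun i => (st i 0).size) fun i => (a i).size :=
    PolyBdd.refl.mono fun i => by simp only [st, Data.size]; omega
  have htest : PolyTime (fun j : Σ i, Fin (N i + 1) => O j.1) (fun j => st j.1 j.2)
      fun j => ofList ((List.ofFn (L j.1)).drop j.2) := refl.snd.fst
  have hbody : PolyTime (fun j : Σ i, Fin (N i) => O j.1) (fun j => st j.1 j.2)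
      fun j => st j.1 (j.2 + 1) := by
    have hid : PolyTime (fun j : Σ i, Fin (N i) => O j.1) (fun j => st j.1 j.2)
        fun j => .pair (a j.1) (.pair (.pair (L j.1 j.2)
          (ofList ((List.ofFn (L j.1)).drop (j.2 + 1)))) (s j.1 j.2)) :=
      refl.congr fun j => by simp only [st, ofList_drop_ofFn]
    exact hid.fst.pair (hid.snd.fst.snd.pair
      ((hid.fst.pair (hid.snd.fst.fst.pair hid.snd.snd)).trans hstep))
  have hloop := loop htest (fun j => ?_) hbody (hmono.trans hL.length)
    (M := fun i => 2 + (a i).size + (ofList (List.ofFn (L i))).size + M i)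
    (hmono.trans ((((PolyBdd.const 2).add .refl).add hL.size).add hM)) (fun i k hk => ?_)
  · exact (hinit.trans hloop).snd.snd
  · have := j.2.isLt
    simp only [ofList_eq_num_zero_iff, List.drop_eq_nil_iff, List.length_ofFn]
    omega
  · have h1 := hs i k hk
    have h2 := size_ofList_drop_le (List.ofFn (L i)) k
    simp only [st, Data.size]
    omega

theorem map_reverse {F : ∀ i, Fin (N i) → Data}
    (hL : PolyTime O a fun i => ofList (List.ofFn (L i)))
    (hF : PolyTime (fun j : Σ i, Fin (N i) => O j.1)
      (fun j => .pair (a j.1) (L j.1 j.2)) fun j => F j.1 j.2) :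
    PolyTime O a fun i => ofList (List.ofFn (F i)).reverse := by
  obtain ⟨B, hB⟩ := hF.size
  let m : ι → ℕ := fun i => B.eval (1 + (a i).size + (ofList (List.ofFn (L i))).size)
  have hm : ∀ i k, (F i k).size ≤ m i := fun i k => (hB ⟨i, k⟩).trans <| by
    refine eval_natPolynomial_mono B ?_
    have : (L i k).size ≤ (ofList (List.ofFn (L i))).size :=
      size_le_size_ofList (List.mem_ofFn.2 ⟨k, rfl⟩)
    simp only [Data.size]
    omega
  have hmb : PolyBdd (fun i => (a i).size) m :=
    (((PolyBdd.const 1).add .refl).add hL.size).trans ⟨B, fun _ => le_rfl⟩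
  have key := fold (s := fun i k => ofList ((List.ofFn (F i)).take k).reverse)
    (M := fun i => 2 + N i * (m i + 1)) hL ((const 0).congr fun i => by simp [ofList]) ?_
    ((PolyBdd.const 2).add (hL.length.mul (hmb.add (.const 1))))
    (fun i k _ => size_ofList_reverse_take_le (hm i) k)
  · exact key.congr fun i => by rw [List.take_of_length_le (by simp)]
  · simp only [ofList_reverse_take_ofFn]
    exact ((refl.fst.pair refl.snd.fst).trans hF).pair refl.snd.snd

theorem reverse {l : ι → List Data} (hl : PolyTime O a fun i => ofList (l i)) :
    PolyTime O a fun i => ofList (l i).reverse := by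
  have h : PolyTime O a fun i => ofList (List.ofFn (l i).get) := hl.congr fun i => by simp
  exact (h.map_reverse (F := fun i => (l i).get) refl.snd).congr fun i => by simp

theorem map {F : ∀ i, Fin (N i) → Data}
    (hL : PolyTime O a fun i => ofList (List.ofFn (L i)))
    (hF : PolyTime (fun j : Σ i, Fin (N i) => O j.1)
      (fun j => .pair (a j.1) (L j.1 j.2)) fun j => F j.1 j.2) :
    PolyTime O a fun i => ofList (List.ofFn (F i)) :=
  (hL.map_reverse hF).reverse.congr fun i => by rw [List.reverse_reverse]

theorem zip {L' : ∀ i, Fin (N i) → Data}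
    (hL : PolyTime O a fun i => ofList (List.ofFn (L i)))
    (hL' : PolyTime O a fun i => ofList (List.ofFn (L' i))) :
    PolyTime O a fun i => ofList (List.ofFn fun k => .pair (L i k) (L' i k)) := by
  let Z : ∀ i, Fin (N i) → Data := fun i k => .pair (L i k) (L' i k)
  let m : ι → ℕ := fun i =>
    1 + (ofList (List.ofFn (L i))).size + (ofList (List.ofFn (L' i))).size
  have hm : ∀ i k, (Z i k).size ≤ m i := fun i k => by
    have h1 : (L i k).size ≤ (ofList (List.ofFn (L i))).size :=
      size_le_size_ofList (List.mem_ofFn.2 ⟨k, rfl⟩)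
    have h2 : (L' i k).size ≤ (ofList (List.ofFn (L' i))).size :=
      size_le_size_ofList (List.mem_ofFn.2 ⟨k, rfl⟩)
    simp only [Z, m, Data.size]
    omega
  have hmb : PolyBdd (fun i => (a i).size) m := ((PolyBdd.const 1).add hL.size).add hL'.size
  -- the accumulator holds the unread part of the second list and the pairs found so far
  have key := fold (s := fun i k => .pair (ofList ((List.ofFn (L' i)).drop k))
      (ofList ((List.ofFn (Z i)).take k).reverse))
    (M := fun i => 1 + (ofList (List.ofFn (L' i))).size + (2 + N i * (m i + 1))) hL
    ((hL'.congr fun i => by simp).pair ((const 0).congr fun i => by simp [ofList])) ?_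
    (((PolyBdd.const 1).add hL'.size).add
      ((PolyBdd.const 2).add (hL.length.mul (hmb.add (.const 1))))) (fun i k _ => ?_)
  · exact key.snd.reverse.congr fun i => by
      rw [List.take_of_length_le (by simp), List.reverse_reverse]
  · simp only [ofList_reverse_take_ofFn, ofList_drop_ofFn]
    exact refl.snd.snd.fst.snd.pair
      ((refl.snd.fst.pair refl.snd.snd.fst.fst).pair refl.snd.snd.snd)
  · have h1 := size_ofList_reverse_take_le (hm i) k
    have h2 := size_ofList_drop_le (List.ofFn (L' i)) k
    simp only [Data.size]
    omega

/-- From a list of length `N`, the list `f 0, …, f N` of the iterates of an affine map, provided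
that their bit lengths grow linearly. -/
theorem iterates {f : ℕ → ℚ} {c d : ℚ} {C : ℕ} (hf : ∀ k, f (k + 1) = c * f k + d)
    (hC : ∀ k, (num (f k)).size ≤ C * (k + 1))
    (hL : PolyTime O a fun i => ofList (List.ofFn (L i))) :
    PolyTime O a fun i => ofList (List.ofFn fun k : Fin (N i + 1) => num (f k)) := by
  have key := fold
    (s := fun _ k => ofList (List.ofFn fun j : Fin (k + 1) => num (f j)).reverse)
    (M := fun i => 2 + (N i + 1) * (C * (N i + 1) + 1)) hL
    (((const (f 0)).pair (const 0)).congr fun i => by simp [ofList]) ?_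
    ((PolyBdd.const 2).add ((hL.length.add (.const 1)).mul
      (((PolyBdd.const C).mul (hL.length.add (.const 1))).add (.const 1)))) (fun i k hk => ?_)
  · exact key.reverse.congr fun i => by rw [List.reverse_reverse]
  · have e : ∀ k, ofList (List.ofFn fun j : Fin (k + 1) => num (f j)).reverse =
        .pair (num (f k)) (ofList (List.ofFn fun j : Fin k => num (f j)).reverse) := fun k => by
      rw [List.ofFn_succ_last]
      simp [ofList]
    have hacc : PolyTime (fun j : Σ i, Fin (N i) => O j.1)
        (fun j => .pair (a j.1) (.pair (L j.1 j.2)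
          (ofList (List.ofFn fun l : Fin (j.2 + 1) => num (f l)).reverse)))
        fun j => .pair (num (f j.2)) (ofList (List.ofFn fun l : Fin j.2 => num (f l)).reverse) :=
      refl.snd.snd.congr fun j => e j.2
    refine (((((const c).mul hacc.fst).add (const d)).pair refl.snd.snd)).congr fun j => ?_
    rw [← hf, ← e]
  · refine (size_ofList_le (m := C * (N i + 1)) fun x hx => ?_).trans ?_
    · obtain ⟨j, rfl⟩ := List.mem_ofFn.1 (List.mem_reverse.1 hx)
      refine (hC j).trans ?_
      have := j.isLt
      gcongr
      omega
    · rw [List.length_reverse, List.length_ofFn]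
      gcongr

end PolyTime

/-! ### Symmetric monotone norms of plateau vectors -/

/-- The vector of length `n` whose first `d` entries are `y` and whose other entries are `0`. -/
def plateau (n d : ℕ) (y : ℚ) : Fin n → ℚ := fun i => if (i : ℕ) < d then y else 0

theorem exists_perm_mapsTo {n : ℕ} {A B : Finset (Fin n)} (h : A.card ≤ B.card) :
    ∃ σ : Equiv.Perm (Fin n), ∀ i ∈ A, σ i ∈ B := by
  obtain ⟨B', hB', hc⟩ := Finset.exists_subset_card_eq h
  let e : {x // x ∈ A} ≃ {x // x ∈ B'} := Finset.equivOfCardEq hc.symm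
  exact ⟨e.extendSubtype, fun i hi => hB' (e.extendSubtype_mem i hi)⟩

theorem card_filter_val_lt (n d : ℕ) :
    (Finset.univ.filter fun i : Fin n => (i : ℕ) < d).card = min n d := by
  rw [Fin.card_filter_val_lt]

theorem induced_nonneg {n : ℕ} {v : Fin n → ℚ} (hv : ∀ i, 0 ≤ v i) (S : Finset (Fin n)) :
    0 ≤ induced v S := fun i => by
  simp only [induced, Pi.zero_apply]
  split_ifs
  · exact_mod_cast hv i
  · exact le_rfl

theorem induced_mono {n : ℕ} {v : Fin n → ℚ} (hv : ∀ i, 0 ≤ v i) {A S : Finset (Fin n)}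
    (h : A ⊆ S) : induced v A ≤ induced v S := fun i => by
  have hi : (0 : ℝ) ≤ v i := by exact_mod_cast hv i
  simp only [induced]
  by_cases h1 : i ∈ A
  · rw [if_pos h1, if_pos (h h1)]
  · rw [if_neg h1]
    split_ifs
    · exact hi
    · exact le_rfl

theorem induced_eq_sum_fiber {n : ℕ} (v : Fin n → ℚ) (S : Finset (Fin n)) (cl : Fin n → ℕ) {m : ℕ}
    (hcl : ∀ e, cl e < m) :
    induced v S = ∑ j ∈ Finset.range m, induced v (S.filter fun e => cl e = j) := by
  ext e
  simp only [Finset.sum_apply, induced, Finset.mem_filter]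
  rw [Finset.sum_eq_single (cl e)]
  · simp
  · intro j _ hj
    rw [if_neg fun h => hj h.2.symm]
  · intro h
    exact absurd (Finset.mem_range.2 (hcl e)) h

namespace IsSymmMonoNorm

variable {n : ℕ} {f : (Fin n → ℝ) → ℝ} {v : Fin n → ℚ} {A : Finset (Fin n)} {d : ℕ} {y : ℚ}

theorem map_zero (hf : IsSymmMonoNorm f) : f 0 = 0 := (hf.eq_zero_iff 0).2 rfl

theorem sum_le (hf : IsSymmMonoNorm f) {β : Type*} (s : Finset β) (u : β → Fin n → ℝ) :
    f (∑ j ∈ s, u j) ≤ ∑ j ∈ s, f (u j) :=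
  Finset.le_sum_of_subadditive f hf.map_zero.le hf.add_le s u

/-- Permuting the coordinates moves `A` into the first `d` positions. -/
theorem induced_le_plateau (hf : IsSymmMonoNorm f) (hv : ∀ i, 0 ≤ v i) (hy : 0 ≤ y)
    (hd : A.card ≤ d) (h : ∀ e ∈ A, v e ≤ y) :
    f (induced v A) ≤ f (realVec (plateau n d y)) := by
  have hc : A.card ≤ (Finset.univ.filter fun i : Fin n => (i : ℕ) < d).card := by
    rw [card_filter_val_lt]
    exact le_min (by simpa using A.card_le_univ) hd
  obtain ⟨σ, hσ⟩ := exists_perm_mapsTo hc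
  rw [← hf.symm σ (realVec (plateau n d y))]
  refine hf.mono _ _ (induced_nonneg hv A) fun i => ?_
  have hy' : (0 : ℝ) ≤ y := by exact_mod_cast hy
  simp only [induced, Function.comp_apply, realVec, plateau]
  by_cases hi : i ∈ A
  · have h1 : ((σ i : Fin n) : ℕ) < d := by simpa using hσ i hi
    rw [if_pos hi, if_pos h1]
    exact_mod_cast h i hi
  · rw [if_neg hi]
    split_ifs
    · exact hy'
    · simp

theorem plateau_le_induced (hf : IsSymmMonoNorm f) (hv : ∀ i, 0 ≤ v i) (hy : 0 ≤ y)
    (hd : d ≤ A.card) (h : ∀ e ∈ A, y ≤ v e) :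
    f (realVec (plateau n d y)) ≤ f (induced v A) := by
  have hc : (Finset.univ.filter fun i : Fin n => (i : ℕ) < d).card ≤ A.card := by
    rw [card_filter_val_lt]
    exact (min_le_right _ _).trans hd
  obtain ⟨σ, hσ⟩ := exists_perm_mapsTo hc
  rw [← hf.symm σ.symm (realVec (plateau n d y))]
  have hy' : (0 : ℝ) ≤ y := by exact_mod_cast hy
  refine hf.mono _ _ (fun i => ?_) fun i => ?_
  · simp only [Pi.zero_apply, Function.comp_apply, realVec, plateau]
    split_ifs
    · exact hy'
    · simp
  · simp only [induced, Function.comp_apply, realVec, plateau]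
    by_cases hi : ((σ.symm i : Fin n) : ℕ) < d
    · have h1 : i ∈ A := by simpa using hσ (σ.symm i) (by simpa using hi)
      rw [if_pos hi, if_pos h1]
      exact_mod_cast h i h1
    · rw [if_neg hi]
      split_ifs
      · exact_mod_cast hv i
      · simp

theorem plateau_one_eq (hf : IsSymmMonoNorm f) (hy : 0 ≤ y) :
    f (realVec (plateau n 1 y)) = y * f (realVec (plateau n 1 1)) := by
  have h : realVec (plateau n 1 y) = (y : ℝ) • realVec (plateau n 1 1) := by
    ext i
    simp only [realVec, plateau, Pi.smul_apply, smul_eq_mul]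
    split_ifs <;> simp
  rw [h, hf.smul, abs_of_nonneg (by exact_mod_cast hy)]

theorem induced_le_sum (hf : IsSymmMonoNorm f) (hv : ∀ i, 0 ≤ v i) :
    f (induced v A) ≤ (∑ e ∈ A, (v e : ℝ)) * f (realVec (plateau n 1 1)) := by
  have h : induced v A = ∑ e ∈ A, induced v {e} := by
    ext i
    simp only [induced, Finset.sum_apply, Finset.mem_singleton]
    rw [Finset.sum_ite_eq]
  rw [h, Finset.sum_mul]
  refine (hf.sum_le _ _).trans (Finset.sum_le_sum fun e _ => ?_)
  rw [← hf.plateau_one_eq (hv e)]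
  exact hf.induced_le_plateau hv (hv e) (by simp) (by simp)

theorem induced_le_of_card_le (hf : IsSymmMonoNorm f) (hv : ∀ i, 0 ≤ v i) {B : ℝ} (hB : 0 ≤ B)
    (hd : A.card ≤ d) (h : ∀ e ∈ A, f (realVec (plateau n d (v e))) ≤ B) :
    f (induced v A) ≤ B := by
  rcases A.eq_empty_or_nonempty with rfl | hA
  · have : induced v ∅ = 0 := by ext i; simp [induced]
    rwa [this, hf.map_zero]
  · obtain ⟨e, he, hmax⟩ := A.exists_max_image v hA
    exact (hf.induced_le_plateau hv (hv e) hd hmax).trans (h e he)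

/-- Cut `A` into pieces of `d` elements and a rest of at most `d`, each of norm at most `B`. -/
theorem induced_le_of_plateau_le (hf : IsSymmMonoNorm f) (hv : ∀ i, 0 ≤ v i) {B : ℝ} (hB : 0 ≤ B)
    (hd : 0 < d) (h : ∀ e ∈ A, f (realVec (plateau n d (v e))) ≤ B) :
    f (induced v A) ≤ (A.card / d + 1) * B := by
  have hd' : (0 : ℝ) < d := by exact_mod_cast hd
  induction hm : A.card using Nat.strong_induction_on generalizing A with
  | _ m ih =>
    rcases le_or_gt A.card d with hc | hc
    · refine (hf.induced_le_of_card_le hv hB hc h).trans ?_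
      have : (0 : ℝ) ≤ m / d := by positivity
      nlinarith
    · obtain ⟨A', hA', hc'⟩ := Finset.exists_subset_card_eq hc.le
      have hcard : (A \ A').card = m - d := by rw [Finset.card_sdiff_of_subset hA', hm, hc']
      have h1 := hf.induced_le_of_card_le hv hB hc'.le fun e he => h e (hA' he)
      have h2 := ih _ (by omega) (A := A \ A')
        (fun e he => h e (Finset.sdiff_subset he)) hcard
      have h3 : induced v A = induced v A' + induced v (A \ A') := by
        ext e
        simp only [induced, Pi.add_apply, Finset.mem_sdiff]
        by_cases h1 : e ∈ A' <;> by_cases h2 : e ∈ A <;> simp [h1, h2]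
        exact absurd (hA' h1) h2
      rw [h3]
      have h4 : (((m - d : ℕ) : ℝ) / d + 1) * B = (m / d + 1) * B - B := by
        rw [Nat.cast_sub (by omega)]
        field_simp
        ring
      have h5 := hf.add_le (induced v A') (induced v (A \ A'))
      linarith

end IsSymmMonoNorm

/-! ### The cost of an element for a guess of the optimum -/

open Classical in
/-- The cost of an element of value `y` for the guess that the optimum is the norm of a single
entry `g`, after the plateau vectors of `y` of lengths `2 ^ i` with `i < k` have been compared with
the guess: the last such vector that is not longer than the guess determines the cost. -/
noncomputable def costAfter {n : ℕ} (f : (Fin n → ℝ) → ℝ) (g y : ℚ) : ℕ → ℚ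
  | 0 => y
  | k + 1 =>
    if f (realVec (plateau n (2 ^ k) y)) ≤ f (realVec (plateau n 1 g)) then
      if n ≤ 2 ^ k then 0 else g / 2 ^ k
    else costAfter f g y k

/-- The cost of an element of value `y`: zero if even `n` copies of `y` have norm at most the guess
`g`, otherwise `g / 2 ^ i` for the largest `i` such that `2 ^ i` copies do, and `y` if a single copy
exceeds the guess. No infinite costs are needed, and none would do, as the factor of the min-sum
algorithm is not known. -/
noncomputable def cost {n : ℕ} (f : (Fin n → ℝ) → ℝ) (g y : ℚ) : ℚ := costAfter f g y (n + 1)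

section Cost

variable {n : ℕ} {f : (Fin n → ℝ) → ℝ} {g y : ℚ} {v : Fin n → ℚ} {S : Finset (Fin n)}

theorem costAfter_nonneg (hg : 0 ≤ g) (hy : 0 ≤ y) (k : ℕ) : 0 ≤ costAfter f g y k := by
  induction k with
  | zero => exact hy
  | succ k ih =>
    simp only [costAfter]
    split_ifs
    · exact le_rfl
    · positivity
    · exact ih

theorem cost_nonneg (hg : 0 ≤ g) (hy : 0 ≤ y) : 0 ≤ cost f g y := costAfter_nonneg hg hy _

theorem costAfter_cases (k : ℕ) :
    (costAfter f g y k = y ∧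
      ∀ j < k, ¬ f (realVec (plateau n (2 ^ j) y)) ≤ f (realVec (plateau n 1 g))) ∨
    ∃ i < k, f (realVec (plateau n (2 ^ i) y)) ≤ f (realVec (plateau n 1 g)) ∧
      costAfter f g y k = (if n ≤ 2 ^ i then 0 else g / 2 ^ i) ∧
      ∀ j < k, i < j → ¬ f (realVec (plateau n (2 ^ j) y)) ≤ f (realVec (plateau n 1 g)) := by
  induction k with
  | zero => exact .inl ⟨rfl, by simp⟩
  | succ k ih =>
    by_cases hk : f (realVec (plateau n (2 ^ k) y)) ≤ f (realVec (plateau n 1 g))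
    · exact .inr ⟨k, by omega, hk, by simp only [costAfter, if_pos hk], fun j h1 h2 => by omega⟩
    · simp only [costAfter, if_neg hk]
      rcases ih with ⟨h1, h2⟩ | ⟨i, hi, h1, h2, h3⟩
      · refine .inl ⟨h1, fun j hj => ?_⟩
        rcases Nat.lt_succ_iff_lt_or_eq.1 hj with hj | rfl
        exacts [h2 j hj, hk]
      · refine .inr ⟨i, by omega, h1, h2, fun j hj hij => ?_⟩
        rcases Nat.lt_succ_iff_lt_or_eq.1 hj with hj | rfl
        exacts [h3 j hj hij, hk]

/-- An element of value `y` belongs to the class `0` if its cost is `y`, to the class `i + 1` if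
its cost is `g / 2 ^ i`, and to the last class, `⌈log₂ n⌉ + 1`, if its cost is zero. -/
theorem exists_costClass (f : (Fin n → ℝ) → ℝ) (g y : ℚ) : ∃ c < Nat.clog 2 n + 2,
    (c = 0 → cost f g y = y ∧ ¬ f (realVec (plateau n 1 y)) ≤ f (realVec (plateau n 1 g))) ∧
    (∀ i < Nat.clog 2 n, c = i + 1 → cost f g y = g / 2 ^ i ∧
      f (realVec (plateau n (2 ^ i) y)) ≤ f (realVec (plateau n 1 g)) ∧
      ¬ f (realVec (plateau n (2 ^ (i + 1)) y)) ≤ f (realVec (plateau n 1 g))) ∧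
    (c = Nat.clog 2 n + 1 → cost f g y = 0 ∧
      f (realVec (plateau n n y)) ≤ f (realVec (plateau n 1 g))) := by
  rcases costAfter_cases (f := f) (g := g) (y := y) (n + 1) with ⟨h1, h2⟩ | ⟨i, hi, h1, h2, h3⟩
  · exact ⟨0, by omega, fun _ => ⟨h1, by simpa using h2 0 (by omega)⟩, fun i _ h => by omega,
      fun h => by omega⟩
  · by_cases hni : n ≤ 2 ^ i
    · refine ⟨Nat.clog 2 n + 1, by omega, fun h => by omega, fun i hi h => by omega,
        fun _ => ⟨by rw [cost, h2, if_pos hni], ?_⟩⟩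
      have : plateau n (2 ^ i) y = plateau n n y := by
        ext j
        have := j.isLt
        simp only [plateau]
        rw [if_pos (by omega), if_pos (by omega)]
      rwa [this] at h1
    · have hiK : i < Nat.clog 2 n := (Nat.lt_clog_iff_pow_lt (by norm_num)).2 (by omega)
      have hin : i < n := (Nat.lt_two_pow_self).trans (by omega)
      refine ⟨i + 1, by omega, fun h => by omega, fun j hj h => ?_, fun h => by omega⟩
      obtain rfl : i = j := by omega
      exact ⟨by rw [cost, h2, if_neg hni], h1, h3 (i + 1) (by omega) (by omega)⟩

theorem sum_eq_sum_fiber (w : Fin n → ℝ) (S : Finset (Fin n)) (cl : Fin n → ℕ) {m : ℕ}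
    (hcl : ∀ e, cl e < m) :
    ∑ e ∈ S, w e = ∑ j ∈ Finset.range m, ∑ e ∈ S.filter (fun e => cl e = j), w e :=
  (Finset.sum_fiberwise_of_maps_to (fun e _ => Finset.mem_range.2 (hcl e)) w).symm

/-- A set of small total cost has small norm: a class of cost `g / 2 ^ i` splits into packets of
`2 ^ i` elements, each of norm at most the guess, and only the last packet may be incomplete. -/
theorem IsSymmMonoNorm.induced_le_sum_cost (hf : IsSymmMonoNorm f) (hv : ∀ i, 0 ≤ v i)
    (hg : 0 ≤ g) (S : Finset (Fin n)) :
    f (induced v S) ≤ (∑ e ∈ S, (cost f g (v e) : ℝ) + (Nat.clog 2 n + 1) * g) *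
      f (realVec (plateau n 1 1)) := by
  choose cl hcl h0 hmid htop using fun e => exists_costClass f g (v e)
  set K := Nat.clog 2 n
  set a := f (realVec (plateau n 1 1))
  have ha : 0 ≤ a := hf.nonneg _
  have hg' : (0 : ℝ) ≤ g := by exact_mod_cast hg
  have hB : f (realVec (plateau n 1 g)) = g * a := hf.plateau_one_eq hg
  have hclass : ∀ j ∈ Finset.range (K + 2), f (induced v (S.filter fun e => cl e = j)) ≤
      (∑ e ∈ S.filter (fun e => cl e = j), (cost f g (v e) : ℝ)) * a +
        if j = 0 then 0 else g * a := by
    intro j hj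
    rw [Finset.mem_range] at hj
    rcases Nat.eq_zero_or_pos j with rfl | hj0
    · rw [if_pos rfl, add_zero, Finset.sum_mul]
      have e1 : induced v (S.filter fun e => cl e = 0) =
          ∑ e ∈ S.filter (fun e => cl e = 0), induced v {e} := by
        ext i
        simp only [induced, Finset.sum_apply, Finset.mem_singleton]
        rw [Finset.sum_ite_eq]
      rw [e1]
      refine (hf.sum_le _ _).trans (Finset.sum_le_sum fun e he => ?_)
      rw [(h0 e (Finset.mem_filter.1 he).2).1, ← hf.plateau_one_eq (hv e)]
      exact hf.induced_le_plateau hv (hv e) (by simp) (by simp)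
    · rw [if_neg hj0.ne']
      rcases lt_or_ge j (K + 1) with hjK | hjK
      · obtain ⟨i, rfl⟩ : ∃ i, j = i + 1 := ⟨j - 1, by omega⟩
        have hm := fun e (he : e ∈ S.filter fun e => cl e = i + 1) =>
          hmid e i (by omega) (Finset.mem_filter.1 he).2
        have key := hf.induced_le_of_plateau_le hv (d := 2 ^ i) (mul_nonneg hg' ha)
          (by positivity) fun e he => (hm e he).2.1.trans hB.le
        rw [Finset.sum_congr rfl fun e he => by rw [(hm e he).1], Finset.sum_const, nsmul_eq_mul]
        refine key.trans (le_of_eq ?_)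
        push_cast
        ring
      · obtain rfl : j = K + 1 := by omega
        have hm := fun e (he : e ∈ S.filter fun e => cl e = K + 1) =>
          htop e (Finset.mem_filter.1 he).2
        rw [Finset.sum_eq_zero fun e he => by rw [(hm e he).1, Rat.cast_zero], zero_mul, zero_add]
        exact hf.induced_le_of_card_le hv (mul_nonneg hg' ha)
          (by simpa using Finset.card_le_univ (S.filter fun e => cl e = K + 1)) fun e he => (hm e he).2.trans hB.le
  rw [induced_eq_sum_fiber v S cl hcl]
  refine ((hf.sum_le _ _).trans (Finset.sum_le_sum hclass)).trans (le_of_eq ?_)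
  rw [Finset.sum_add_distrib, ← Finset.sum_mul, ← sum_eq_sum_fiber _ S cl hcl,
    Finset.sum_range_succ' _ (K + 1)]
  simp only [Nat.add_eq_zero_iff, one_ne_zero, and_false, if_false, if_true, Finset.sum_const,
    Finset.card_range, nsmul_eq_mul]
  push_cast
  ring

/-- A set whose norm is within the guess has small total cost: it has fewer than `2 ^ (i + 1)`
elements of cost `g / 2 ^ i`. -/
theorem IsSymmMonoNorm.sum_cost_le (hf : IsSymmMonoNorm f) (hn : 2 ≤ n) (hv : ∀ i, 0 ≤ v i)
    (hg : 0 ≤ g) (hS : f (induced v S) ≤ f (realVec (plateau n 1 g))) :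
    ∑ e ∈ S, (cost f g (v e) : ℝ) ≤ (2 * Nat.clog 2 n - 1) * g := by
  choose cl hcl h0 hmid htop using fun e => exists_costClass f g (v e)
  have hK : 0 < Nat.clog 2 n := Nat.clog_pos (by norm_num) hn
  set K := Nat.clog 2 n
  have hg' : (0 : ℝ) ≤ g := by exact_mod_cast hg
  have hsub : ∀ {A : Finset (Fin n)} {y : ℚ} {d : ℕ}, A ⊆ S → 0 ≤ y → d ≤ A.card →
      (∀ e ∈ A, y ≤ v e) → f (realVec (plateau n d y)) ≤ f (realVec (plateau n 1 g)) :=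
    fun hA hy hd h => ((hf.plateau_le_induced hv hy hd h).trans
      (hf.mono _ _ (induced_nonneg hv _) (induced_mono hv hA))).trans hS
  have hclass : ∀ i < K, ∑ e ∈ S.filter (fun e => cl e = i + 1), (cost f g (v e) : ℝ) ≤
      (2 - if i = 0 then 1 else 0) * g := by
    intro i hi
    set A := S.filter fun e => cl e = i + 1
    have hm := fun e (he : e ∈ A) => hmid e i hi (Finset.mem_filter.1 he).2
    have hcard : A.card + 1 ≤ 2 ^ (i + 1) := by
      by_contra hc
      have hc' : 2 ^ (i + 1) ≤ A.card := by omega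
      obtain ⟨e, he, hmin⟩ := A.exists_min_image v
        (Finset.card_pos.1 (lt_of_lt_of_le (by positivity) hc'))
      exact (hm e he).2.2 (hsub (Finset.filter_subset _ _) (hv e) hc' hmin)
    rw [Finset.sum_congr rfl fun e he => by rw [(hm e he).1], Finset.sum_const, nsmul_eq_mul]
    have hcard' : (A.card : ℝ) + 1 ≤ 2 ^ (i + 1) := by exact_mod_cast hcard
    push_cast
    rw [mul_div_assoc', div_le_iff₀ (by positivity), mul_right_comm]
    refine mul_le_mul_of_nonneg_right ?_ hg'
    rw [pow_succ] at hcard'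
    split_ifs with hi0
    · subst hi0
      norm_num at hcard ⊢
      omega
    · linarith
  rw [sum_eq_sum_fiber _ S cl hcl, Finset.sum_range_succ, Finset.sum_range_succ' _ K]
  have hbot : ∑ e ∈ S.filter (fun e => cl e = 0), (cost f g (v e) : ℝ) = 0 := by
    refine Finset.sum_eq_zero fun e he => ?_
    rw [Finset.mem_filter] at he
    exact absurd (hsub (A := {e}) (by simpa using he.1) (hv e) (by simp) (by simp)) (h0 e he.2).2
  have htop' : ∑ e ∈ S.filter (fun e => cl e = K + 1), (cost f g (v e) : ℝ) = 0 :=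
    Finset.sum_eq_zero fun e he => by
      rw [(htop e (Finset.mem_filter.1 he).2).1, Rat.cast_zero]
  rw [hbot, htop', add_zero, add_zero]
  refine (Finset.sum_le_sum fun i hi => hclass i (Finset.mem_range.1 hi)).trans (le_of_eq ?_)
  rw [← Finset.sum_mul, Finset.sum_sub_distrib, Finset.sum_ite_eq' (Finset.range K) 0,
    if_pos (Finset.mem_range.2 hK), Finset.sum_const, Finset.card_range, nsmul_eq_mul]
  ring

end Cost

/-! ### Guessing the optimum -/

/-- The ratios of the guesses to the largest value in an optimal set. The ratio `0` serves the case
that the optimum is zero. -/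
def guessRatio : ℕ → ℚ
  | 0 => 0
  | k + 1 => (4 / 3) ^ k

theorem guessRatio_nonneg (k : ℕ) : 0 ≤ guessRatio k := by
  cases k with
  | zero => exact le_rfl
  | succ k => simp only [guessRatio]; positivity

theorem natCast_le_four_thirds_pow (n : ℕ) : (n : ℝ) ≤ (4 / 3) ^ (n + 1) := by
  rcases lt_or_ge n 3 with h | h
  · interval_cases n <;> norm_num
  · induction n, h using Nat.le_induction with
    | base => norm_num
    | succ m hm ih =>
      have : (3 : ℝ) ≤ m := by exact_mod_cast hm
      rw [pow_succ]
      push_cast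
      linarith

/-- The norm of `S` lies between those of one and of `n` copies of its largest value, and the powers
of `4/3` up to exponent `n + 1` cover this range. -/
theorem IsSymmMonoNorm.exists_guess {n : ℕ} {f : (Fin n → ℝ) → ℝ} (hf : IsSymmMonoNorm f)
    (hn : 0 < n) {v : Fin n → ℚ} (hv : ∀ i, 0 ≤ v i) (S : Finset (Fin n)) :
    ∃ (e : Fin n) (k : Fin (n + 3)),
      f (induced v S) ≤ f (realVec (plateau n 1 (v e * guessRatio k))) ∧
      f (realVec (plateau n 1 (v e * guessRatio k))) ≤ 4 / 3 * f (induced v S) := by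
  set z := f (induced v S)
  set a := f (realVec (plateau n 1 1))
  have ha : 0 ≤ a := hf.nonneg _
  have hval : ∀ e k, f (realVec (plateau n 1 (v e * guessRatio k))) = v e * a * guessRatio k :=
    fun e k => by
      rw [hf.plateau_one_eq (mul_nonneg (hv e) (guessRatio_nonneg k))]
      push_cast
      ring
  simp only [hval]
  rcases (hf.nonneg (induced v S)).eq_or_lt with hz | hz
  · refine ⟨⟨0, hn⟩, 0, ?_⟩
    simp [guessRatio, z, ← hz]
  · have hS : S.Nonempty := by
      rw [Finset.nonempty_iff_ne_empty]
      rintro rfl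
      have : induced v ∅ = 0 := by ext i; simp [induced]
      rw [this, hf.map_zero] at hz
      exact hz.false
    obtain ⟨e, he, hmax⟩ := S.exists_max_image v hS
    have hlow : v e * a ≤ z := by
      rw [← hf.plateau_one_eq (hv e)]
      refine (hf.plateau_le_induced (A := {e}) hv (hv e) (by simp) (by simp)).trans ?_
      exact hf.mono _ _ (induced_nonneg hv _) (induced_mono hv (by simpa using he))
    have hve : (0 : ℝ) ≤ v e := by exact_mod_cast hv e
    have hup : z ≤ v e * a * n := by
      refine (hf.induced_le_sum hv).trans ?_
      have h1 : ∑ i ∈ S, (v i : ℝ) ≤ n * v e := by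
        refine (Finset.sum_le_card_nsmul S _ (v e : ℝ) fun i hi => ?_).trans ?_
        · exact_mod_cast hmax i hi
        · rw [nsmul_eq_mul]
          gcongr
          simpa using Finset.card_le_univ S
      calc (∑ i ∈ S, (v i : ℝ)) * a ≤ n * v e * a := by gcongr
        _ = v e * a * n := by ring
    have hva : (0 : ℝ) ≤ v e * a := by positivity
    have hex : ∃ k : ℕ, z ≤ v e * a * (4 / 3) ^ k :=
      ⟨n + 1, hup.trans (mul_le_mul_of_nonneg_left (natCast_le_four_thirds_pow n) hva)⟩
    classical
    have hk : Nat.find hex ≤ n + 1 := Nat.find_min' hex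
      (hup.trans (mul_le_mul_of_nonneg_left (natCast_le_four_thirds_pow n) hva))
    refine ⟨e, ⟨Nat.find hex + 1, by omega⟩, ?_⟩
    simp only [guessRatio]
    push_cast
    refine ⟨Nat.find_spec hex, ?_⟩
    rcases Nat.eq_zero_or_pos (Nat.find hex) with h0 | h0
    · rw [h0, pow_zero, mul_one]
      linarith
    · have hlt := Nat.find_min hex (Nat.sub_lt h0 one_pos)
      rw [not_le] at hlt
      obtain ⟨m, hm⟩ : ∃ m, Nat.find hex = m + 1 := ⟨Nat.find hex - 1, by omega⟩
      rw [hm, Nat.add_sub_cancel] at hlt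
      rw [hm, pow_succ]
      linarith

/-- Small cost for the right guess means a small norm. -/
theorem IsSymmMonoNorm.induced_le_of_sum_cost_le {n : ℕ} {f : (Fin n → ℝ) → ℝ}
    (hf : IsSymmMonoNorm f) (hn : 2 ≤ n) {v : Fin n → ℚ} (hv : ∀ i, 0 ≤ v i) {g : ℚ} (hg : 0 ≤ g)
    {α : ℝ} (hα : 1 ≤ α) {S S' : Finset (Fin n)}
    (hS' : f (induced v S') ≤ f (realVec (plateau n 1 g)))
    (hS : ∑ e ∈ S, (cost f g (v e) : ℝ) ≤ α * ∑ e ∈ S', (cost f g (v e) : ℝ)) :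
    f (induced v S) ≤ 3 * α * Nat.clog 2 n * f (realVec (plateau n 1 g)) := by
  have h1 := hf.induced_le_sum_cost hv hg S
  have h2 := hf.sum_cost_le hn hv hg hS'
  have hK : (1 : ℝ) ≤ Nat.clog 2 n := by exact_mod_cast Nat.clog_pos (by norm_num) hn
  rw [hf.plateau_one_eq hg]
  set K : ℝ := (Nat.clog 2 n : ℝ)
  have hg' : (0 : ℝ) ≤ g := by exact_mod_cast hg
  have ha : 0 ≤ f (realVec (plateau n 1 1)) := hf.nonneg _
  refine h1.trans ?_
  rw [← mul_assoc]
  refine mul_le_mul_of_nonneg_right ?_ ha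
  have h3 : α * ∑ e ∈ S', (cost f g (v e) : ℝ) ≤ α * ((2 * K - 1) * g) :=
    mul_le_mul_of_nonneg_left h2 (by linarith)
  have h4 : 0 ≤ (α - 1) * (K + 1) * g := by
    have : 0 ≤ α - 1 := by linarith
    positivity
  nlinarith

/-! ### Norm minimization by a program -/

/-- A program without oracles as a program with oracles. -/
def Prog.lift {κ : Type} : Prog Empty → Prog κ
  | .prim o => .prim o
  | .query k => k.elim
  | .pair p q => .pair p.lift q.lift
  | .seq p q => .seq p.lift q.lift
  | .ite c p q => .ite c.lift p.lift q.lift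
  | .loop c p => .loop c.lift p.lift

theorem Runs.lift {κ : Type} {O : Empty → Data → Data} (O' : κ → Data → Data) {p : Prog Empty}
    {x y : Data} {t : ℕ} (h : Runs O p x y t) : Runs O' p.lift x y t := by
  induction h with
  | prim o x => exact .prim o x
  | query k x => exact k.elim
  | pair _ _ h1 h2 => exact .pair h1 h2
  | seq _ _ h1 h2 => exact .seq h1 h2
  | ite_true _ hb _ h1 h2 => exact .ite_true h1 hb h2
  | ite_false _ hb _ h1 h2 => exact .ite_false h1 hb h2
  | loop_stop _ hb h1 => exact Runs.loop_stop h1 hb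
  | loop_step _ hb _ _ h1 h2 h3 => exact .loop_step h1 hb h2 h3

/-- An input of the norm minimization version of `P`, with the norm and its oracle. -/
structure NormInput (P : CombProblem) where
  x : Data
  mem_inst : x ∈ P.inst
  v : Fin (P.n x) → ℚ
  v_nonneg : ∀ i, 0 ≤ v i
  f : (Fin (P.n x) → ℝ) → ℝ
  isNorm : IsSymmMonoNorm f
  oracle : Data → Data
  isOracle : IsNormOracle f oracle

namespace NormInput

variable {P : CombProblem}

/-- The number of elements of the ground set. -/
abbrev card (e : NormInput P) : ℕ := P.n e.x

/-- The part of the input that a program gets to see. -/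
def code (e : NormInput P) : Data := .pair e.x (.ofVec e.v)

/-- The oracle of the input as the only member of a family. -/
def oracles (e : NormInput P) : Unit → Data → Data := fun _ => e.oracle

end NormInput

theorem realVec_mul_incidence {n : ℕ} (v : Fin n → ℚ) (S : Finset (Fin n)) :
    realVec (fun i => v i * if i ∈ S then 1 else 0) = induced v S := by
  ext i
  simp only [realVec, induced]
  split_ifs <;> simp

theorem Data.size_num_pow_le (c : ℚ) (k : ℕ) :
    (num (c ^ k)).size ≤ ((num c).size + 3) * (k + 1) := by
  induction k with
  | zero => rw [pow_zero, size_num_one]; omega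
  | succ k ih =>
    rw [pow_succ]
    have := size_num_mul_le (c ^ k) c
    have e : ((num c).size + 3) * (k + 1 + 1) =
      ((num c).size + 3) * (k + 1) + ((num c).size + 3) := by ring
    omega

theorem Data.size_num_natCast_le (k : ℕ) : (num (k : ℚ)).size ≤ 3 * (k + 1) := by
  have : Nat.size k ≤ k := Nat.size_le.2 Nat.lt_two_pow_self
  have h1 : Nat.size 1 = 1 := by simp
  simp only [size, Rat.num_natCast, Int.natAbs_natCast, Rat.den_natCast, h1]
  omega

theorem Data.size_ofSet_le {n : ℕ} (S : Finset (Fin n)) : (ofSet S).size ≤ 2 + n * 4 := by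
  refine (size_ofList_le (m := 3) fun x hx => ?_).trans (by simp)
  obtain ⟨j, rfl⟩ := List.mem_ofFn.1 hx
  simp only
  split_ifs
  · rw [size_num_one]
  · rw [size_num_zero]; omega

open Classical in
/-- Of the set `b` and the first `k` sets of a family, one that induces a vector of smallest
norm. -/
noncomputable def bestOf {n N : ℕ} (f : (Fin n → ℝ) → ℝ) (v : Fin n → ℚ)
    (F : Fin N → Finset (Fin n)) (b : Finset (Fin n)) : ℕ → Finset (Fin n)
  | 0 => b
  | k + 1 =>
    if h : k < N then
      if f (induced v (F ⟨k, h⟩)) ≤ f (induced v (bestOf f v F b k)) then F ⟨k, h⟩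
      else bestOf f v F b k
    else bestOf f v F b k

section BestOf

variable {n N : ℕ} (f : (Fin n → ℝ) → ℝ) (v : Fin n → ℚ) (F : Fin N → Finset (Fin n))
  {b : Finset (Fin n)}

theorem bestOf_mem {s : Set (Finset (Fin n))} (hb : b ∈ s) (hF : ∀ k, F k ∈ s) (k : ℕ) :
    bestOf f v F b k ∈ s := by
  induction k with
  | zero => exact hb
  | succ k ih =>
    simp only [bestOf]
    split_ifs
    exacts [hF _, ih, ih]

theorem bestOf_le (b : Finset (Fin n)) (j : Fin N) (k : ℕ) (hjk : (j : ℕ) < k) :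
    f (induced v (bestOf f v F b k)) ≤ f (induced v (F j)) := by
  induction k with
  | zero => omega
  | succ k ih =>
    simp only [bestOf]
    rcases Nat.lt_succ_iff_lt_or_eq.1 hjk with hj | hj
    · split_ifs with h1 h2
      exacts [h2.trans (ih hj), ih hj, ih hj]
    · subst hj
      rw [dif_pos j.isLt]
      split_ifs with h2
      exacts [le_rfl, (not_le.1 h2).le]

end BestOf

namespace PolyTime

open Data

section

variable {P : CombProblem} {ι : Type*} {E : ι → NormInput P} {a : ι → Data}

/-- What can be computed before a fold or a map can also be computed inside its step, whose family
is indexed by an index and a position in the list. -/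
theorem step_of {κ : Type} {O : ι → κ → Data → Data} {N : ι → ℕ} {b : ι → Data}
    {c : (Σ i, Fin (N i)) → Data} (h : PolyTime O a b) :
    PolyTime (fun j : Σ i, Fin (N i) => O j.1) (fun j => .pair (a j.1) (c j)) fun j => b j.1 :=
  refl.fst.trans (h.reindex Sigma.fst)

theorem range_succ (hE : PolyTime (fun i => (E i).oracles) a fun i => (E i).code) :
    PolyTime (fun i => (E i).oracles) a fun i => .pair (num ((E i).card : ℚ))
      (ofList (List.ofFn fun k : Fin (E i).card => num ((k : ℕ) : ℚ)).reverse) := by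
  have h := iterates (f := fun k => (k : ℚ)) (c := 1) (d := 1) (C := 3)
    (fun k => by push_cast; ring) size_num_natCast_le hE.snd
  refine h.reverse.congr fun i => ?_
  rw [List.ofFn_succ_last]
  simp [ofList]

theorem card (hE : PolyTime (fun i => (E i).oracles) a fun i => (E i).code) :
    PolyTime (fun i => (E i).oracles) a fun i => num ((E i).card : ℚ) := hE.range_succ.fst

theorem range (hE : PolyTime (fun i => (E i).oracles) a fun i => (E i).code) :
    PolyTime (fun i => (E i).oracles) a
      fun i => ofList (List.ofFn fun k : Fin (E i).card => num ((k : ℕ) : ℚ)) :=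
  hE.range_succ.snd.reverse.congr fun i => by rw [List.reverse_reverse]

theorem two_pow (hE : PolyTime (fun i => (E i).oracles) a fun i => (E i).code) :
    PolyTime (fun i => (E i).oracles) a
      fun i => ofList (List.ofFn fun k : Fin ((E i).card + 1) => num (2 ^ (k : ℕ))) :=
  iterates (f := fun k => (2 : ℚ) ^ k) (c := 2) (d := 0) (fun k => by rw [pow_succ]; ring)
    (size_num_pow_le 2) hE.snd

theorem guessRatios (hE : PolyTime (fun i => (E i).oracles) a fun i => (E i).code) :
    PolyTime (fun i => (E i).oracles) a
      fun i => ofList (List.ofFn fun k : Fin ((E i).card + 3) => num (guessRatio k)) := by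
  have h := iterates (f := fun k => (4 / 3 : ℚ) ^ k) (c := 4 / 3) (d := 0)
    (fun k => by rw [pow_succ]; ring) (size_num_pow_le (4 / 3)) hE.two_pow
  refine ((const 0).pair h).congr fun i => ?_
  rw [List.ofFn_succ]
  simp [ofList, guessRatio]

theorem plateau {d : ι → ℕ} {y : ι → ℚ}
    (hE : PolyTime (fun i => (E i).oracles) a fun i => (E i).code)
    (hd : PolyTime (fun i => (E i).oracles) a fun i => num (d i : ℚ))
    (hy : PolyTime (fun i => (E i).oracles) a fun i => num (y i)) :
    PolyTime (fun i => (E i).oracles) a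
      fun i => ofVec (MinNorm.plateau (E i).card (d i) (y i)) := by
  refine hE.range.map
    (F := fun i k => num (MinNorm.plateau (E i).card (d i) (y i) k)) ?_
  refine (ite_le hd.step_of refl.snd (const 0) hy.step_of).congr fun j => ?_
  simp only [MinNorm.plateau, Nat.cast_le]
  split_ifs <;> first | rfl | omega

open Classical in
/-- Branching on a comparison of two norms by the oracle. -/
theorem ite_norm_le {u w : ∀ i, Fin (E i).card → ℚ} {b c : ι → Data}
    (hu : PolyTime (fun i => (E i).oracles) a fun i => ofVec (u i))
    (hw : PolyTime (fun i => (E i).oracles) a fun i => ofVec (w i))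
    (hb : PolyTime (fun i => (E i).oracles) a b) (hc : PolyTime (fun i => (E i).oracles) a c) :
    PolyTime (fun i => (E i).oracles) a
      fun i => if (E i).f (realVec (u i)) ≤ (E i).f (realVec (w i)) then b i else c i := by
  have hans : ∀ i, (E i).oracles () (.pair (ofVec (u i)) (ofVec (w i))) =
      if (E i).f (realVec (u i)) ≤ (E i).f (realVec (w i)) then num 1 else num 0 :=
    fun i => (E i).isOracle (u i) (w i)
  refine ite ((query () (hu.pair hw) ((PolyBdd.const 3).mono fun i => ?_)).congr hans) hb hc
  rw [hans]
  split_ifs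
  · rw [size_num_one]
  · rw [size_num_zero]; omega

theorem cost {g y : ι → ℚ} (hE : PolyTime (fun i => (E i).oracles) a fun i => (E i).code)
    (hg : PolyTime (fun i => (E i).oracles) a fun i => num (g i))
    (hy : PolyTime (fun i => (E i).oracles) a fun i => num (y i)) :
    PolyTime (fun i => (E i).oracles) a
      fun i => num (MinNorm.cost (E i).f (g i) (y i)) := by
  let C := (num 2).size + 3
  refine hE.two_pow.fold (s := fun i k => num (costAfter (E i).f (g i) (y i) k))
    (M := fun i => (num (y i)).size + (2 + ((num (g i)).size + (C * ((E i).card + 1) + 1))))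
    hy ?_ (hy.size.add ((PolyBdd.const 2).add (hg.size.add (((PolyBdd.const C).mul
      hE.two_pow.length).add (.const 1))))) fun i k hk => ?_
  · have hpow : PolyTime (fun j : Σ i, Fin ((E i).card + 1) => (E j.1).oracles)
        (fun j => .pair (a j.1) (.pair (num (2 ^ (j.2 : ℕ)))
          (num (costAfter (E j.1).f (g j.1) (y j.1) j.2))))
        fun j => num (2 ^ (j.2 : ℕ)) := refl.snd.fst
    refine (ite_norm_le (hE.step_of.plateau (d := fun j => 2 ^ (j.2 : ℕ))
      (hpow.congr fun j => by push_cast; rfl) hy.step_of)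
      (hE.step_of.plateau (d := fun _ => 1) ((const 1).congr fun j => by simp) hg.step_of)
      (ite_le hE.step_of.card hpow (const 0) (hg.step_of.div hpow)) refl.snd.snd).congr
      fun j => ?_
    have hcast : (((E j.1).card : ℚ) ≤ 2 ^ (j.2 : ℕ)) ↔ (E j.1).card ≤ 2 ^ (j.2 : ℕ) := by
      exact_mod_cast Iff.rfl
    simp only [costAfter, hcast]
    split_ifs <;> rfl
  · induction k with
    | zero => simp only [costAfter]; omega
    | succ k ih =>
      simp only [costAfter]
      split_ifs
      · rw [size_num_zero]; omega
      · have h1 := size_num_mul_le (g i) ((2 : ℚ) ^ k)⁻¹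
        have h2 := size_num_inv_le ((2 : ℚ) ^ k)
        have h3 := size_num_pow_le 2 k
        have h4 : C * (k + 1) ≤ C * ((E i).card + 1) := Nat.mul_le_mul_left C hk
        rw [← div_eq_mul_inv] at h1
        simp only [C] at h4 ⊢
        omega
      · exact ih (by omega)

theorem costs {g : ι → ℚ} (hE : PolyTime (fun i => (E i).oracles) a fun i => (E i).code)
    (hg : PolyTime (fun i => (E i).oracles) a fun i => num (g i)) :
    PolyTime (fun i => (E i).oracles) a
      fun i => ofVec fun e => MinNorm.cost (E i).f (g i) ((E i).v e) :=
  hE.snd.map (F := fun i e => num (MinNorm.cost (E i).f (g i) ((E i).v e)))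
    (cost hE.step_of hg.step_of refl.snd)

theorem inducedVec {S : ∀ i, Finset (Fin (E i).card)}
    (hE : PolyTime (fun i => (E i).oracles) a fun i => (E i).code)
    (hS : PolyTime (fun i => (E i).oracles) a fun i => ofSet (S i)) :
    PolyTime (fun i => (E i).oracles) a
      fun i => ofVec fun e => (E i).v e * if e ∈ S i then 1 else 0 :=
  (hE.snd.zip hS).map (F := fun i e => num ((E i).v e * if e ∈ S i then 1 else 0))
    (refl.snd.fst.mul refl.snd.snd)

theorem bestOf {N : ι → ℕ} (hN : ∀ i, 0 < N i) {F : ∀ i, Fin (N i) → Finset (Fin (E i).card)}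
    (hE : PolyTime (fun i => (E i).oracles) a fun i => (E i).code)
    (hF : PolyTime (fun i => (E i).oracles) a
      fun i => ofList (List.ofFn fun k => ofSet (F i k))) :
    PolyTime (fun i => (E i).oracles) a
      fun i => ofSet (MinNorm.bestOf (E i).f (E i).v (F i) (F i ⟨0, hN i⟩) (N i)) := by
  refine hF.fold
    (s := fun i k => ofSet (MinNorm.bestOf (E i).f (E i).v (F i) (F i ⟨0, hN i⟩) k))
    (M := fun i => 2 + (E i).card * 4) ?_ ?_
    ((PolyBdd.const 2).add (hE.snd.length.mul (.const 4))) fun i k _ => size_ofSet_le _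
  · refine fst (c := fun i => ofList ((List.ofFn fun k => ofSet (F i k)).drop 1))
      (hF.congr fun i => ?_)
    simpa [MinNorm.bestOf] using ofList_drop_ofFn (fun k => ofSet (F i k)) ⟨0, hN i⟩
  · refine (ite_norm_le
      (hE.step_of.inducedVec (S := fun j : Σ i, Fin (N i) => F j.1 j.2) refl.snd.fst)
      (hE.step_of.inducedVec refl.snd.snd) refl.snd.fst refl.snd.snd).congr fun j => ?_
    rw [realVec_mul_incidence, realVec_mul_incidence]
    simp only [MinNorm.bestOf, dif_pos j.2.isLt]
    split_ifs <;> rfl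

end

end PolyTime

end MinNorm

open MinNorm in
theorem theorem4p6 (P : MinNorm.CombProblem) (hn : ∀ x ∈ P.inst, 2 ≤ P.n x)
    (α : ℕ → ℝ) (hα : ∀ n, 1 ≤ α n) (h : MinNorm.HasPolyMinSumApprox P α)
    (ε : ℝ) (hε : 0 < ε) :
    MinNorm.HasPolyMinNormApprox P
      (fun n => 4 * α n * (⌈Real.logb 2 (n : ℝ)⌉ : ℝ) + ε) := by
  obtain ⟨p, T, hp⟩ := h
  choose Sol t hrun ht hfeas hopt using hp
  -- the candidate sets: one for every element of the ground set and every ratio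
  let guess : ∀ E : NormInput P, Fin E.card → Fin (E.card + 3) → ℚ := fun E e k =>
    E.v e * guessRatio k
  have hguess : ∀ E e k, 0 ≤ guess E e k := fun E e k =>
    mul_nonneg (E.v_nonneg e) (guessRatio_nonneg k)
  have hcost : ∀ (E : NormInput P) e k i, 0 ≤ cost E.f (guess E e k) (E.v i) := fun E e k i =>
    cost_nonneg (hguess E e k) (E.v_nonneg i)
  let cand : ∀ E : NormInput P, Fin E.card → Fin (E.card + 3) → Finset (Fin E.card) :=
    fun E e k => Sol E.x E.mem_inst _ (hcost E e k)
  -- the best candidate for a fixed element, then the best of all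
  let row : ∀ E : NormInput P, Fin E.card → Finset (Fin E.card) := fun E e =>
    bestOf E.f E.v (cand E e) (cand E e ⟨0, by omega⟩) (E.card + 3)
  have hcard : ∀ E : NormInput P, 0 < E.card := fun E => by
    have := hn E.x E.mem_inst
    simp only [NormInput.card]
    omega
  let out : ∀ E : NormInput P, Finset (Fin E.card) := fun E =>
    bestOf E.f E.v (row E) (row E ⟨0, hcard E⟩) E.card
  have hcandTime : PolyTime
      (fun j : Σ i : (Σ E : NormInput P, Fin E.card), Fin (i.1.card + 3) => j.1.1.oracles)
      (fun j => .pair (.pair j.1.1.code (.num (j.1.1.v j.1.2))) (.num (guessRatio j.2)))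
      fun j => .ofSet (cand j.1.1 j.1.2 j.2) := by
    have hE : PolyTime
        (fun j : Σ i : (Σ E : NormInput P, Fin E.card), Fin (i.1.card + 3) => j.1.1.oracles)
        (fun j => .pair (.pair j.1.1.code (.num (j.1.1.v j.1.2))) (.num (guessRatio j.2)))
        fun j => j.1.1.code := PolyTime.refl.fst.fst
    refine (hE.fst.pair (hE.costs (PolyTime.refl.fst.snd.mul PolyTime.refl.snd))).trans ?_
    exact ⟨p.lift, _, fun j => (hrun j.1.1.x j.1.1.mem_inst _ (hcost _ j.1.2 j.2)).lift _,
      T, fun j => ht j.1.1.x j.1.1.mem_inst _ (hcost _ j.1.2 j.2)⟩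
  have hrowTime : PolyTime (fun j : Σ E : NormInput P, Fin E.card => j.1.oracles)
      (fun j => .pair j.1.code (.num (j.1.v j.2))) fun j => .ofSet (row j.1 j.2) := by
    have hE : PolyTime (fun j : Σ E : NormInput P, Fin E.card => j.1.oracles)
      (fun j => .pair j.1.code (.num (j.1.v j.2))) fun j => j.1.code := PolyTime.refl.fst
    exact hE.bestOf (fun _ => by omega)
      (hE.guessRatios.map (F := fun j k => .ofSet (cand j.1 j.2 k)) hcandTime)
  have houtTime : PolyTime (fun E : NormInput P => E.oracles) (fun E => E.code)
      fun E => .ofSet (out E) :=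
    PolyTime.refl.bestOf hcard
      (PolyTime.refl.snd.map (F := fun E e => .ofSet (row E e)) hrowTime)
  obtain ⟨p', t', hrun', T', ht'⟩ := houtTime
  -- the approximation factor: compare with the candidate for the right guess
  refine ⟨p', T', fun x hx v hv f hf O hO => ?_⟩
  let E : NormInput P := ⟨x, hx, v, hv, f, hf, O, hO⟩
  have hcandFeas : ∀ e k, cand E e k ∈ P.feasible x := fun e k => hfeas x hx _ (hcost E e k)
  have hrowFeas : ∀ e, row E e ∈ P.feasible x := fun e =>
    bestOf_mem _ _ _ (hcandFeas e _) (hcandFeas e) _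
  refine ⟨out E, t' E, hrun' E, ht' E, bestOf_mem _ _ _ (hrowFeas _) hrowFeas _,
    fun S' hS' => ?_⟩
  have hn' : 2 ≤ P.n x := hn x hx
  obtain ⟨e, k, hlow, hup⟩ := hf.exists_guess (hcard E) hv S'
  have hout : f (induced v (out E)) ≤ f (induced v (cand E e k)) :=
    (bestOf_le f v (row E) _ e _ e.isLt).trans (bestOf_le f v (cand E e) _ k _ k.isLt)
  have hcand := hf.induced_le_of_sum_cost_le hn' hv (hguess E e k) (hα (P.n x)) hlow
    (hopt x hx _ (hcost E e k) S' hS')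
  have hlog : (⌈Real.logb 2 (P.n x : ℝ)⌉ : ℝ) = Nat.clog 2 (P.n x) := by
    have := Real.ceil_logb_natCast (b := 2) (Nat.cast_nonneg (P.n x) : (0 : ℝ) ≤ P.n x)
    rw [Int.clog_natCast] at this
    exact_mod_cast congrArg (Int.cast : ℤ → ℝ) this
  have hK : (0 : ℝ) ≤ 3 * α (P.n x) * Nat.clog 2 (P.n x) := by
    have := hα (P.n x)
    positivity
  calc f (induced v (out E))
      ≤ 3 * α (P.n x) * Nat.clog 2 (P.n x) * (4 / 3 * f (induced v S')) :=
        (hout.trans hcand).trans (mul_le_mul_of_nonneg_left hup hK)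
    _ ≤ (4 * α (P.n x) * (⌈Real.logb 2 (P.n x : ℝ)⌉ : ℝ) + ε) * f (induced v S') := by
        rw [hlog]
        have := mul_nonneg hε.le (hf.nonneg (induced v S'))
        linarith
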